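/- Let $\omega\in\mathbb R$ and let $d=n_0$, $m=n_{L+1}$ and $L\ge 0$ be fixed non-negative integers. For hidden widths $n_1,\dots,n_L\ge 1$, the simple sinusoidal network with $L$ hidden layers is the random function $f^{(L)}:\mathbb R^{d}\to\mathbb R^{m}$ defined by $$f^{(0)}(x)=\omega\,(W^{(0)}x+b^{(0)}),\qquad f^{(l)}(x)=W^{(l)}\,\tfrac{1}{\sqrt{n_l}}\,\sin\!\big(f^{(l-1)}(x)\big)+b^{(l)}\quad(1\le l\le L),$$ where $\sin$ acts coordinatewise, $W^{(l)}$ is an $n_{l+1}\times n_l$ matrix, $b^{(l)}\in\mathbb R^{n_{l+1}}$, and all entries of all $W^{(l)}$ and $b^{(l)}$ are independent $\mathcal N(0,1)$ random variables. Define $\Sigma^{(l)}:\mathbb R^{d}\times\mathbb R^{d}\to\mathbb R$ recursively by $$\Sigma^{(0)}(x,\tilde x)=\omega^2\,(x^T\tilde x+1),$$ $$\Sigma^{(l)}(x,\tilde x)=\tfrac12\,e^{-\frac12\left(\Sigma^{(l-1)}(x,x)+\Sigma^{(l-1)}(\tilde x,\tilde x)\right)}\left(e^{\Sigma^{(l-1)}(x,\tilde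 x)}-e^{-\Sigma^{(l-1)}(x,\tilde x)}\right)+1\qquad(l\ge1).$$ Then there is a centered Gaussian process $G$ indexed by $\mathbb R^{d}$ with values in $\mathbb R^{m}$, with independent coordinates each having covariance function $\Sigma^{(L)}$, i.e. $\operatorname{Cov}(G_i(x),G_j(\tilde x))=\delta_{ij}\,\Sigma^{(L)}(x,\tilde x)$, such that $f^{(L)}$ tends to $G$ as $n_1,\dots,n_L\to\infty$ sequentially (first $n_1$, last $n_L$), in the sense of weak convergence of finite-dimensional distributions: for every finite set $S\subset\mathbb R^{d}$, $$\lim_{n_L\to\infty}\cdots\lim_{n_2\to\infty}\lim_{n_1\to\infty}\operatorname{Law}\big(f^{(L)}|_S\big)=\operatorname{Law}\big(G|_S\big),$$ where all the limits are weak limits of probability measures and each inner limit exists for all positive values of the remaining widths. (For $L=0$ there is no limit, and the two laws are equal.) -/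

import Mathlib

open MeasureTheory ProbabilityTheory Filter Topology

/-- The parameters `(W, b)` of an affine layer `ℝᵃ → ℝᵇ`: a `b × a` matrix of weights and a
vector of `b` biases. -/
abbrev LayerParams (a b : ℕ) : Type := (Fin b → Fin a → ℝ) × (Fin b → ℝ)

/-- All entries of `W` and of `b` are independent standard Gaussians. -/
noncomputable def layerLaw (a b : ℕ) : Measure (LayerParams a b) :=
  (Measure.pi fun _ : Fin b => Measure.pi fun _ : Fin a => gaussianReal 0 1).prod
    (Measure.pi fun _ : Fin b => gaussianReal 0 1)

instance (a b : ℕ) : IsProbabilityMeasure (layerLaw a b) := by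
  unfold layerLaw; infer_instance

/-- The affine map `v ↦ W v + b`. -/
noncomputable def affineLayer {a b : ℕ} (θ : LayerParams a b) (v : EuclideanSpace ℝ (Fin a)) :
    EuclideanSpace ℝ (Fin b) :=
  WithLp.toLp 2 fun i => (∑ j, θ.1 i j * v j) + θ.2 i

/-- The parameters `(W⁽⁰⁾, b⁽⁰⁾), …, (W⁽ᴸ⁾, b⁽ᴸ⁾)` of a fully connected network with `L` hidden
layers, input dimension `d`, hidden widths `n 0, …, n (L - 1)` and output dimension `m`. The last
component is the output layer; the rest parametrizes the network with `L - 1` hidden layers whose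
output is the last hidden layer. -/
def NetParams (d : ℕ) : (L : ℕ) → (Fin L → ℕ) → ℕ → Type
  | 0, _, m => LayerParams d m
  | L + 1, n, m =>
      NetParams d L (Fin.init n) (n (Fin.last L)) × LayerParams (n (Fin.last L)) m

instance instMeasurableSpaceNetParams (d : ℕ) :
    (L : ℕ) → (n : Fin L → ℕ) → (m : ℕ) → MeasurableSpace (NetParams d L n m)
  | 0, _, _ => inferInstanceAs (MeasurableSpace (LayerParams d _))
  | L + 1, n, _ =>
      @Prod.instMeasurableSpace _ _
        (instMeasurableSpaceNetParams d L (Fin.init n) (n (Fin.last L))) inferInstance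

/-- The law of the parameters at initialization: all weights and biases of all layers are
independent standard Gaussians. -/
noncomputable def paramLaw (d : ℕ) :
    (L : ℕ) → (n : Fin L → ℕ) → (m : ℕ) → Measure (NetParams d L n m)
  | 0, _, m => layerLaw d m
  | L + 1, n, m =>
      (paramLaw d L (Fin.init n) (n (Fin.last L))).prod (layerLaw (n (Fin.last L)) m)

instance instIsProbabilityMeasureParamLaw (d : ℕ) :
    (L : ℕ) → (n : Fin L → ℕ) → (m : ℕ) → IsProbabilityMeasure (paramLaw d L n m)
  | 0, _, _ => inferInstanceAs (IsProbabilityMeasure (layerLaw d _))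
  | L + 1, n, _ =>
      @Measure.prod.instIsProbabilityMeasure _ _ _ _ _ _
        (instIsProbabilityMeasureParamLaw d L (Fin.init n) (n (Fin.last L))) inferInstance

/-- The sinusoidal network `f⁽ᴸ⁾` with `L` hidden layers:
`f⁽⁰⁾(x) = ω (W⁽⁰⁾ x + b⁽⁰⁾)` and `f⁽ᴸ⁾(x) = W⁽ᴸ⁾ (1 / √n_L) sin (f⁽ᴸ⁻¹⁾(x)) + b⁽ᴸ⁾`. -/
noncomputable def sinNet (ω : ℝ) (d : ℕ) :
    (L : ℕ) → (n : Fin L → ℕ) → (m : ℕ) → NetParams d L n m →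
      EuclideanSpace ℝ (Fin d) → EuclideanSpace ℝ (Fin m)
  | 0, _, _, θ, x => ω • affineLayer θ x
  | L + 1, n, _, θ, x =>
      affineLayer θ.2 (WithLp.toLp 2 fun j =>
        1 / √(n (Fin.last L) : ℝ) *
          Real.sin (sinNet ω d L (Fin.init n) (n (Fin.last L)) θ.1 x j))

lemma measurable_sinNet_apply (ω : ℝ) (d : ℕ) (L : ℕ) (n : Fin L → ℕ) (m : ℕ)
    (x : EuclideanSpace ℝ (Fin d)) : Measurable fun θ => sinNet ω d L n m θ x := by
  induction L generalizing m with
  | zero =>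
    change Measurable fun θ : LayerParams d m => ω • affineLayer θ x
    unfold affineLayer
    fun_prop
  | succ L ih =>
    have h := ih (Fin.init n) (n (Fin.last L))
    change Measurable fun θ : NetParams d L (Fin.init n) (n (Fin.last L)) ×
      LayerParams (n (Fin.last L)) m => affineLayer θ.2 (WithLp.toLp 2 fun j =>
        1 / √(n (Fin.last L) : ℝ) *
          Real.sin (sinNet ω d L (Fin.init n) (n (Fin.last L)) θ.1 x j))
    unfold affineLayer
    fun_prop

lemma measurable_sinNet (ω : ℝ) (d : ℕ) (L : ℕ) (n : Fin L → ℕ) (m : ℕ) :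
    Measurable (sinNet ω d L n m) :=
  measurable_pi_lambda _ fun x => measurable_sinNet_apply ω d L n m x

/-- The law at initialization of the network output, as a random function
`ℝᵈ → ℝᵐ`. -/
noncomputable def sinNetLaw (ω : ℝ) (d L : ℕ) (n : Fin L → ℕ) (m : ℕ) :
    ProbabilityMeasure (EuclideanSpace ℝ (Fin d) → EuclideanSpace ℝ (Fin m)) :=
  ⟨(paramLaw d L n m).map (sinNet ω d L n m),
    Measure.isProbabilityMeasure_map (measurable_sinNet ω d L n m).aemeasurable⟩

/-- The finite-dimensional distribution on the finite set `S` of a random function. -/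
noncomputable def finDimLaw {T F : Type*} [MeasurableSpace F] (μ : ProbabilityMeasure (T → F))
    (S : Finset T) : ProbabilityMeasure (S → F) :=
  μ.map (f := S.restrict) (Finset.measurable_restrict S).aemeasurable

/-- `G` is the law of a centered Gaussian process indexed by `T` with values in `ℝᵐ`, whose `m`
coordinates are independent, each with covariance function `K`. (Coordinates of a jointly Gaussian
process are independent if and only if they are uncorrelated.) -/
structure IsCenteredGaussianProcessLaw {T : Type*} {m : ℕ}
    (G : ProbabilityMeasure (T → EuclideanSpace ℝ (Fin m))) (K : T → T → ℝ) : Prop where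
  isGaussianProcess :
    IsGaussianProcess (fun (x : T) (z : T → EuclideanSpace ℝ (Fin m)) => z x)
      (G : Measure (T → EuclideanSpace ℝ (Fin m)))
  mean_eq_zero : ∀ (x : T) (i : Fin m), ∫ z, z x i
    ∂(G : Measure (T → EuclideanSpace ℝ (Fin m))) = 0
  covariance_eq : ∀ (x y : T) (i j : Fin m),
    cov[fun z => z x i, fun z => z y j; (G : Measure (T → EuclideanSpace ℝ (Fin m)))] = if i = j then K x y else 0

/-- `SeqLimit L F a`: letting the arguments `n 0, …, n (L - 1)` (positive integers) of `F` tend to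
infinity one after another, in this order, `F n` tends to `a`, i.e.
`lim_{n (L-1) → ∞} ⋯ lim_{n 1 → ∞} lim_{n 0 → ∞} F n = a`, with all inner limits existing. For the
outermost limit, `g k` is the iterated inner limit with the last argument fixed to `k`. -/
def SeqLimit {X : Type*} [TopologicalSpace X] : (L : ℕ) → ((Fin L → ℕ) → X) → X → Prop
  | 0, F, a => F Fin.elim0 = a
  | L + 1, F, a => ∃ g : ℕ → X,
      (∀ k : ℕ, 0 < k → SeqLimit L (fun n => F (Fin.snoc n k)) (g k)) ∧
        Tendsto g atTop (𝓝 a)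

/-- The covariance recursion `Σ⁽⁰⁾, Σ⁽¹⁾, …`. -/
noncomputable def ssnKernel (ω : ℝ) (d : ℕ) :
    ℕ → EuclideanSpace ℝ (Fin d) → EuclideanSpace ℝ (Fin d) → ℝ
  | 0, x, y => ω ^ 2 * (inner ℝ x y + 1)
  | L + 1, x, y =>
      1 / 2 * Real.exp (-(1 / 2) * (ssnKernel ω d L x x + ssnKernel ω d L y y)) *
        (Real.exp (ssnKernel ω d L x y) - Real.exp (-ssnKernel ω d L x y)) + 1

/-! Given the values `z` of the previous layer, the next layer is Gaussian, so its characteristic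
function is the expectation over `z` of an explicit real exponential
(`integral_exp_hiddenLayerLaw`). If the `k` coordinates of `z` are i.i.d. copies of a Gaussian
process, this expectation factorises as `e^(-β/2) (E e^(-Y/k))^k` with `Y ≥ 0` bounded, and tends to
`e^(-β/2 - E Y)`. The Gaussian formula for `E[sin z_x sin z_y]` identifies the exponent with the
quadratic form of the next kernel, and Lévy's theorem gives weak convergence
(`tendsto_hiddenLayerLaw`).

The theorem follows by induction on depth. With the last hidden width fixed at `k`, the inner limits
give the i.i.d. Gaussian input exactly, because adding a layer is a weakly continuous operation on
laws (`continuous_hiddenLayerLaw`).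

The limit processes exist because each kernel is a Gram kernel: the next one is the inner product of
the features `(sin z_x, 1)` in `L² × ℝ`. A Hilbert space embeds isometrically into the Gaussian
variables of a white noise, which turns features into a process (`exists_hasGaussianCharFun`). -/

/-! ### Characteristic functions: `L²` continuity and standard Gaussian vectors. -/

lemma norm_exp_mul_I_sub_le (a b : ℝ) :
    ‖Complex.exp (a * Complex.I) - Complex.exp (b * Complex.I)‖ ≤ |a - b| := by
  have h : Complex.exp (a * Complex.I) - Complex.exp (b * Complex.I) =
      Complex.exp (b * Complex.I) * (Complex.exp (Complex.I * ((a - b : ℝ) : ℂ)) - 1) := by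
    rw [mul_sub, ← Complex.exp_add]
    push_cast
    ring_nf
  rw [h, norm_mul, Complex.norm_exp_ofReal_mul_I, one_mul]
  exact Real.norm_exp_I_mul_ofReal_sub_one_le

lemma integrable_exp_mul_I {Ω : Type*} [MeasurableSpace Ω] {μ : Measure Ω} [IsFiniteMeasure μ]
    {f : Ω → ℝ} (hf : AEStronglyMeasurable f μ) :
    Integrable (fun x => Complex.exp (f x * Complex.I)) μ := by
  refine Integrable.of_bound (C := 1) ?_ (Eventually.of_forall fun x => ?_)
  · exact Complex.continuous_exp.comp_aestronglyMeasurable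
      ((Complex.continuous_ofReal.comp_aestronglyMeasurable hf).mul_const _)
  · rw [Complex.norm_exp_ofReal_mul_I]

/-- The characteristic functional is continuous on `L²`. -/
lemma continuous_integral_exp_mul_I {Ω : Type*} [MeasurableSpace Ω] (μ : Measure Ω)
    [IsProbabilityMeasure μ] :
    Continuous fun f : Lp ℝ 2 μ => ∫ x, Complex.exp (f x * Complex.I) ∂μ := by
  -- The functional is 1-Lipschitz: `t ↦ e^(it)` is, and the `L¹` norm is at most the `L²` norm for
  -- a probability measure.
  refine (LipschitzWith.of_dist_le_mul (K := 1) fun f g => ?_).continuous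
  have hf := (Lp.memLp f).aestronglyMeasurable
  have hg := (Lp.memLp g).aestronglyMeasurable
  have hfg : MemLp (fun x => f x - g x) 2 μ := (Lp.memLp f).sub (Lp.memLp g)
  rw [dist_eq_norm, ← integral_sub (integrable_exp_mul_I hf) (integrable_exp_mul_I hg)]
  calc ‖∫ x, (Complex.exp (f x * Complex.I) - Complex.exp (g x * Complex.I)) ∂μ‖
      ≤ ∫ x, ‖f x - g x‖ ∂μ := by
        refine norm_integral_le_of_norm_le (hfg.integrable (by norm_num)).norm
          (Eventually.of_forall fun x => ?_)
        exact norm_exp_mul_I_sub_le _ _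
    _ = (eLpNorm (fun x => f x - g x) 1 μ).toReal := by
        rw [integral_norm_eq_lintegral_enorm hfg.aestronglyMeasurable,
          eLpNorm_one_eq_lintegral_enorm]
    _ ≤ (eLpNorm (fun x => f x - g x) 2 μ).toReal :=
        ENNReal.toReal_mono hfg.eLpNorm_ne_top
          (eLpNorm_le_eLpNorm_of_exponent_le (by norm_num) hfg.aestronglyMeasurable)
    _ = ((1 : NNReal) : ℝ) * dist f g := by
        rw [Lp.dist_def]
        simp only [NNReal.coe_one, one_mul]
        rfl

lemma integral_exp_mul_I_gaussianReal (a : ℝ) :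
    ∫ x, Complex.exp (((a * x : ℝ) : ℂ) * Complex.I) ∂(gaussianReal 0 1) =
      ((Real.exp (-(a ^ 2 / 2)) : ℝ) : ℂ) := by
  have h := charFun_gaussianReal (μ := 0) (v := 1) a
  rw [charFun_apply_real] at h
  push_cast
  rw [h]
  congr 1
  push_cast
  ring

lemma integral_exp_sum_mul_I_pi_gaussianReal {ι : Type*} [Fintype ι] (a : ι → ℝ) :
    ∫ x, Complex.exp (((∑ i, a i * x i : ℝ) : ℂ) * Complex.I)
        ∂(Measure.pi fun _ : ι => gaussianReal 0 1) =
      ((Real.exp (-((∑ i, a i ^ 2) / 2)) : ℝ) : ℂ) := by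
  have h : ∀ x : ι → ℝ, Complex.exp (((∑ i, a i * x i : ℝ) : ℂ) * Complex.I) =
      ∏ i, Complex.exp (((a i * x i : ℝ) : ℂ) * Complex.I) := fun x => by
    rw [← Complex.exp_sum, ← Finset.sum_mul]
    push_cast
    rfl
  simp_rw [h]
  rw [integral_fintype_prod_eq_prod
    (f := fun i y => Complex.exp (((a i * y : ℝ) : ℂ) * Complex.I))]
  simp_rw [integral_exp_mul_I_gaussianReal]
  rw [← Complex.ofReal_prod, ← Real.exp_sum, Finset.sum_neg_distrib, Finset.sum_div]

/-! ### White noise and the Wiener integral. -/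

section Isonormal

variable (ι : Type*)

/-- A family of independent standard Gaussian variables. -/
noncomputable abbrev whiteNoise : Measure (ι → ℝ) := Measure.infinitePi fun _ => gaussianReal 0 1

variable {ι}

lemma memLp_eval_whiteNoise (i : ι) : MemLp (fun x : ι → ℝ => x i) 2 (whiteNoise ι) :=
  (memLp_id_gaussianReal' 2 (by norm_num)).comp_measurePreserving
    (measurePreserving_eval_infinitePi _ i)

lemma orthonormal_eval_whiteNoise :
    Orthonormal ℝ fun i : ι => (memLp_eval_whiteNoise i).toLp (fun x : ι → ℝ => x i) := by
  classical
  rw [orthonormal_iff_ite]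
  intro i j
  have h1 : inner ℝ ((memLp_eval_whiteNoise i).toLp (fun x : ι → ℝ => x i))
      ((memLp_eval_whiteNoise j).toLp (fun x : ι → ℝ => x j)) =
      ∫ x : ι → ℝ, x i * x j ∂(whiteNoise ι) := by
    rw [L2.inner_def]
    refine integral_congr_ae ?_
    filter_upwards [(memLp_eval_whiteNoise i).coeFn_toLp, (memLp_eval_whiteNoise j).coeFn_toLp]
      with x hi hj
    rw [hi, hj]
    simp [mul_comm]
  rw [h1]
  have hmean : ∀ i : ι, ∫ x : ι → ℝ, x i ∂(whiteNoise ι) = 0 := fun i => by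
    rw [(measurePreserving_eval_infinitePi (fun _ : ι => gaussianReal 0 1) i).hasLaw.integral_eq]
    exact integral_id_gaussianReal
  split_ifs with hij
  · subst hij
    have h2 := (measurePreserving_eval_infinitePi (fun _ : ι => gaussianReal 0 1)
      i).hasLaw.variance_eq
    rw [variance_id_gaussianReal] at h2
    rw [variance_of_integral_eq_zero (measurable_pi_apply i).aemeasurable (hmean i)] at h2
    simpa [sq] using h2
  · have hind : iIndepFun (fun i (x : ι → ℝ) => x i) (whiteNoise ι) :=
      iIndepFun_infinitePi (X := fun _ x => x) (fun _ => measurable_id)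
    have h3 := (hind.indepFun hij).integral_fun_mul_eq_mul_integral
      (memLp_eval_whiteNoise i).aestronglyMeasurable (memLp_eval_whiteNoise j).aestronglyMeasurable
    rw [h3, hmean, zero_mul]

/-- The Wiener integral `ℓ²(ι) → L²` with respect to white noise. -/
noncomputable def wienerIsometry (ι : Type*) :
    lp (fun _ : ι => ℝ) 2 →ₗᵢ[ℝ] Lp ℝ 2 (whiteNoise ι) :=
  (orthonormal_eval_whiteNoise (ι := ι)).orthogonalFamily.linearIsometry

lemma coeFn_sum_smul_Lp {α Ω : Type*} [MeasurableSpace Ω] {μ : Measure Ω} (s : Finset α)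
    (c : α → ℝ) (f : α → Lp ℝ 2 μ) :
    ((∑ i ∈ s, c i • f i : Lp ℝ 2 μ) : Ω → ℝ) =ᵐ[μ] fun x => ∑ i ∈ s, c i * f i x := by
  have h : ∀ᵐ x ∂μ, ∀ i : s, ((c i • f i : Lp ℝ 2 μ) : Ω → ℝ) x = c i * f i x := by
    rw [ae_all_iff]
    intro i
    filter_upwards [Lp.coeFn_smul (c i) (f i)] with x hx
    rw [hx, Pi.smul_apply, smul_eq_mul]
  filter_upwards [Lp.coeFn_finsetSum s fun i => c i • f i, h] with x hx hx'
  rw [hx, Finset.sum_apply]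
  exact Finset.sum_congr rfl fun i hi => hx' ⟨i, hi⟩

lemma integral_exp_finset_sum_whiteNoise (s : Finset ι) (a : ι → ℝ) :
    ∫ x, Complex.exp (((∑ i ∈ s, a i * x i : ℝ) : ℂ) * Complex.I) ∂(whiteNoise ι) =
      ((Real.exp (-((∑ i ∈ s, a i ^ 2) / 2)) : ℝ) : ℂ) := by
  have h := integral_restrict_infinitePi (μ := fun _ : ι => gaussianReal 0 1) (s := s)
    (f := fun y : s → ℝ => Complex.exp (((∑ i : s, a i * y i : ℝ) : ℂ) * Complex.I))
    (Measurable.aestronglyMeasurable (by fun_prop))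
  rw [integral_exp_sum_mul_I_pi_gaussianReal (fun i : s => a i),
    Finset.sum_coe_sort s (fun i => a i ^ 2)] at h
  rw [← h]
  refine integral_congr_ae (Eventually.of_forall fun x => ?_)
  simp only [Finset.restrict]
  rw [Finset.sum_coe_sort s (fun i => a i * x i)]

lemma integral_exp_wienerIsometry (h : lp (fun _ : ι => ℝ) 2) :
    ∫ x, Complex.exp ((wienerIsometry ι h x : ℝ) * Complex.I) ∂(whiteNoise ι) =
      ((Real.exp (-(‖h‖ ^ 2 / 2)) : ℝ) : ℂ) := by
  obtain ⟨a, ha⟩ : ∃ a : ι → ℝ, a = h := ⟨_, rfl⟩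
  have hsum : HasSum (fun i => a i • (memLp_eval_whiteNoise i).toLp (fun x : ι → ℝ => x i))
      (wienerIsometry ι h) := by
    rw [ha]
    exact (orthonormal_eval_whiteNoise (ι := ι)).orthogonalFamily.hasSum_linearIsometry h
  have hnorm : HasSum (fun i => a i ^ 2) (‖h‖ ^ 2) := by
    have := lp.hasSum_norm (p := 2) (by norm_num) h
    rw [ha]
    simpa using this
  -- Both sides are limits along finite subsets of `ι`, on which the identity is the
  -- finite-dimensional one.
  refine tendsto_nhds_unique (((continuous_integral_exp_mul_I (whiteNoise ι)).tendsto _).comp hsum)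
    (((Complex.continuous_ofReal.tendsto _).comp <| (Real.continuous_exp.tendsto _).comp
      (Tendsto.neg (Tendsto.div_const hnorm 2))).congr fun s => ?_)
  rw [Function.comp_apply, Function.comp_apply, Function.comp_apply,
    ← integral_exp_finset_sum_whiteNoise]
  refine integral_congr_ae ?_
  have h1 : ∀ᵐ x ∂(whiteNoise ι), ∀ i : s,
      (memLp_eval_whiteNoise (i : ι)).toLp (fun x : ι → ℝ => x i) x = x i :=
    ae_all_iff.2 fun i => (memLp_eval_whiteNoise (i : ι)).coeFn_toLp
  filter_upwards [coeFn_sum_smul_Lp s a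
    fun i => (memLp_eval_whiteNoise i).toLp (fun x : ι → ℝ => x i), h1] with x hx hx'
  have h2 : ∑ i ∈ s, a i * (memLp_eval_whiteNoise i).toLp (fun x : ι → ℝ => x i) x =
      ∑ i ∈ s, a i * x i :=
    Finset.sum_congr rfl fun i hi => congrArg (a i * ·) (hx' ⟨i, hi⟩)
  exact congrArg (fun r : ℝ => Complex.exp (r * Complex.I)) (hx.trans h2).symm

end Isonormal

/-! ### Gaussian processes from feature maps. -/

/-- The finite-dimensional characteristic functions of the law `P` are those of a centered
Gaussian process with covariance function `K`. -/
def HasGaussianCharFun {T : Type*} (P : Measure (T → ℝ)) (K : T → T → ℝ) : Prop :=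
  ∀ (S : Finset T) (c : T → ℝ),
    ∫ z, Complex.exp (((∑ x ∈ S, c x * z x : ℝ) : ℂ) * Complex.I) ∂P =
      ((Real.exp (-((∑ x ∈ S, ∑ y ∈ S, c x * c y * K x y) / 2)) : ℝ) : ℂ)

lemma norm_sum_smul_sq {T H : Type*} [NormedAddCommGroup H] [InnerProductSpace ℝ H]
    (S : Finset T) (c : T → ℝ) (φ : T → H) :
    ‖∑ x ∈ S, c x • φ x‖ ^ 2 = ∑ x ∈ S, ∑ y ∈ S, c x * c y * inner ℝ (φ x) (φ y) := by
  rw [← real_inner_self_eq_norm_sq, sum_inner]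
  simp_rw [inner_sum, real_inner_smul_left, real_inner_smul_right, mul_assoc]

/-- Every kernel with a feature map into a Hilbert space is the covariance function of a
centered Gaussian process. -/
theorem exists_hasGaussianCharFun {T H : Type*} [NormedAddCommGroup H] [InnerProductSpace ℝ H]
    [CompleteSpace H] (φ : T → H) :
    ∃ P : ProbabilityMeasure (T → ℝ),
      HasGaussianCharFun (P : Measure (T → ℝ)) fun x y => inner ℝ (φ x) (φ y) := by
  obtain ⟨w, b, -⟩ := exists_hilbertBasis ℝ H
  -- Hilbert basis coordinates followed by the Wiener integral: `H` becomes a space of centered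
  -- Gaussian variables.
  let J : H →ₗᵢ[ℝ] Lp ℝ 2 (whiteNoise w) := (wienerIsometry w).comp b.repr.toLinearIsometry
  have hmeas : Measurable fun (ξ : w → ℝ) (x : T) => (J (φ x) : (w → ℝ) → ℝ) ξ :=
    measurable_pi_lambda _ fun x => (Lp.stronglyMeasurable (J (φ x))).measurable
  refine ⟨⟨(whiteNoise w).map fun ξ x => (J (φ x) : (w → ℝ) → ℝ) ξ,
    Measure.isProbabilityMeasure_map hmeas.aemeasurable⟩, fun S c => ?_⟩
  rw [ProbabilityMeasure.coe_mk, integral_map hmeas.aemeasurable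
    (Measurable.aestronglyMeasurable (by fun_prop))]
  rw [← norm_sum_smul_sq, ← b.repr.norm_map, ← integral_exp_wienerIsometry]
  refine integral_congr_ae ?_
  filter_upwards [coeFn_sum_smul_Lp S c fun x => J (φ x)] with ξ hξ
  rw [← hξ]
  simp only [← map_smul, ← map_sum]
  rfl

/-- The sign of `v` comes for free, since a characteristic function has modulus at most 1 (taken at
`t = 1`). Positive semidefiniteness of a kernel thus needs no separate check. -/
lemma map_eq_gaussianReal_of_integral_exp {Ω : Type*} [MeasurableSpace Ω] {μ : Measure Ω}
    [IsProbabilityMeasure μ] {X : Ω → ℝ} (hX : Measurable X) {v : ℝ}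
    (h : ∀ t : ℝ, ∫ ω, Complex.exp (((t * X ω : ℝ) : ℂ) * Complex.I) ∂μ =
      ((Real.exp (-(t ^ 2 * v / 2)) : ℝ) : ℂ)) :
    0 ≤ v ∧ μ.map X = gaussianReal 0 v.toNNReal := by
  have hprob : IsProbabilityMeasure (μ.map X) := Measure.isProbabilityMeasure_map hX.aemeasurable
  have hchar : ∀ t : ℝ, charFun (μ.map X) t = ((Real.exp (-(t ^ 2 * v / 2)) : ℝ) : ℂ) := fun t => by
    rw [← h, charFun_apply_real, integral_map hX.aemeasurable (by fun_prop)]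
    push_cast
    rfl
  have hv : 0 ≤ v := by
    have h1 := norm_charFun_le_one (μ := μ.map X) (1 : ℝ)
    rw [hchar, Complex.norm_real, Real.norm_of_nonneg (Real.exp_pos _).le, Real.exp_le_one_iff] at h1
    linarith
  refine ⟨hv, Measure.ext_of_charFun <| funext fun t => ?_⟩
  rw [hchar, charFun_gaussianReal, Real.coe_toNNReal _ hv]
  push_cast
  congr 1
  ring

/-! ### Vector-valued Gaussian processes with independent coordinates. -/

section VectorValued

variable {T : Type*} {m : ℕ}

/-- The finite-dimensional characteristic functions of `G` are those of a centered Gaussian process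
with independent coordinates, each with covariance function `K`. -/
def HasGaussianVecCharFun (G : Measure (T → EuclideanSpace ℝ (Fin m))) (K : T → T → ℝ) : Prop :=
  ∀ (S : Finset T) (c : T → Fin m → ℝ),
    ∫ z, Complex.exp (((∑ x ∈ S, ∑ i, c x i * z x i : ℝ) : ℂ) * Complex.I) ∂G =
      ((Real.exp (-((∑ i, ∑ x ∈ S, ∑ y ∈ S, c x i * c y i * K x y) / 2)) : ℝ) : ℂ)

lemma HasGaussianVecCharFun.map_eq_gaussianReal {G : Measure (T → EuclideanSpace ℝ (Fin m))}
    [IsProbabilityMeasure G] {K : T → T → ℝ} (h : HasGaussianVecCharFun G K) (S : Finset T)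
    (c : T → Fin m → ℝ) :
    0 ≤ ∑ i, ∑ x ∈ S, ∑ y ∈ S, c x i * c y i * K x y ∧
      G.map (fun z => ∑ x ∈ S, ∑ i, c x i * z x i) =
        gaussianReal 0 (∑ i, ∑ x ∈ S, ∑ y ∈ S, c x i * c y i * K x y).toNNReal := by
  refine map_eq_gaussianReal_of_integral_exp (by fun_prop) fun t => ?_
  have h1 := h S fun x i => t * c x i
  simp only [Finset.mul_sum, ← mul_assoc] at h1 ⊢
  rw [h1]
  have h2 : ∀ i x y, t * c x i * t * c y i * K x y = t ^ 2 * c x i * c y i * K x y :=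
    fun i x y => by ring
  simp only [h2]

lemma HasGaussianVecCharFun.memLp_two {G : Measure (T → EuclideanSpace ℝ (Fin m))}
    [IsProbabilityMeasure G] {K : T → T → ℝ} (h : HasGaussianVecCharFun G K) (S : Finset T)
    (c : T → Fin m → ℝ) : MemLp (fun z => ∑ x ∈ S, ∑ i, c x i * z x i) 2 G := by
  have h1 : MemLp id 2 (G.map fun z => ∑ x ∈ S, ∑ i, c x i * z x i) := by
    rw [(h.map_eq_gaussianReal S c).2]
    exact memLp_id_gaussianReal' 2 (by norm_num)
  have h2 : Measurable fun z : T → EuclideanSpace ℝ (Fin m) => ∑ x ∈ S, ∑ i, c x i * z x i := by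
    fun_prop
  exact (memLp_map_measure_iff aestronglyMeasurable_id h2.aemeasurable).1 h1

lemma HasGaussianVecCharFun.integral_eq_zero {G : Measure (T → EuclideanSpace ℝ (Fin m))}
    [IsProbabilityMeasure G] {K : T → T → ℝ} (h : HasGaussianVecCharFun G K) (S : Finset T)
    (c : T → Fin m → ℝ) : ∫ z, ∑ x ∈ S, ∑ i, c x i * z x i ∂G = 0 := by
  have hX : HasLaw (fun z => ∑ x ∈ S, ∑ i, c x i * z x i) _ G :=
    ⟨Measurable.aemeasurable (by fun_prop), (h.map_eq_gaussianReal S c).2⟩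
  rw [hX.integral_eq]
  exact integral_id_gaussianReal

lemma HasGaussianVecCharFun.variance_eq {G : Measure (T → EuclideanSpace ℝ (Fin m))}
    [IsProbabilityMeasure G] {K : T → T → ℝ} (h : HasGaussianVecCharFun G K) (S : Finset T)
    (c : T → Fin m → ℝ) :
    Var[fun z => ∑ x ∈ S, ∑ i, c x i * z x i; G] =
      ∑ i, ∑ x ∈ S, ∑ y ∈ S, c x i * c y i * K x y := by
  have hX : HasLaw (fun z => ∑ x ∈ S, ∑ i, c x i * z x i) _ G :=
    ⟨Measurable.aemeasurable (by fun_prop), (h.map_eq_gaussianReal S c).2⟩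
  rw [hX.variance_eq, variance_id_gaussianReal, Real.coe_toNNReal _ (h.map_eq_gaussianReal S c).1]

/-- Polarization: the variance of a sum is again a quadratic form, and symmetry of `K` merges the
two cross terms. -/
lemma HasGaussianVecCharFun.covariance_sum_eq {G : Measure (T → EuclideanSpace ℝ (Fin m))}
    [IsProbabilityMeasure G] {K : T → T → ℝ} (h : HasGaussianVecCharFun G K)
    (hK : ∀ x y, K x y = K y x) (S : Finset T) (a b : T → Fin m → ℝ) :
    cov[fun z => ∑ x ∈ S, ∑ i, a x i * z x i, fun z => ∑ x ∈ S, ∑ i, b x i * z x i; G] =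
      ∑ i, ∑ x ∈ S, ∑ y ∈ S, a x i * b y i * K x y := by
  have h1 := variance_fun_add (h.memLp_two S a) (h.memLp_two S b)
  have h2 : (fun z : T → EuclideanSpace ℝ (Fin m) =>
      ∑ x ∈ S, ∑ i, a x i * z x i + ∑ x ∈ S, ∑ i, b x i * z x i) =
      fun z => ∑ x ∈ S, ∑ i, (a x i + b x i) * z x i := by
    funext z
    simp only [add_mul, Finset.sum_add_distrib]
  have h3 : ∑ i, ∑ x ∈ S, ∑ y ∈ S, b x i * a y i * K x y =
      ∑ i, ∑ x ∈ S, ∑ y ∈ S, a x i * b y i * K x y := by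
    refine Finset.sum_congr rfl fun i _ => ?_
    rw [Finset.sum_comm]
    refine Finset.sum_congr rfl fun x _ => Finset.sum_congr rfl fun y _ => ?_
    rw [hK y x]
    ring
  rw [h2, h.variance_eq S fun x i => a x i + b x i, h.variance_eq, h.variance_eq] at h1
  simp only [add_mul, mul_add, Finset.sum_add_distrib] at h1
  linarith

lemma strongDual_apply_eq_sum {S : Type*} [Fintype S] [DecidableEq S]
    (L : StrongDual ℝ (S → EuclideanSpace ℝ (Fin m))) (w : S → EuclideanSpace ℝ (Fin m)) :
    L w = ∑ x, ∑ i, L (Pi.single x (EuclideanSpace.single i 1)) * w x i := by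
  have h : w = ∑ x, ∑ i, w x i • Pi.single x (EuclideanSpace.single i (1 : ℝ)) := by
    funext x
    ext i
    simp [Finset.sum_apply, Pi.single_apply, apply_ite, Finset.sum_ite_eq]
  conv_lhs => rw [h]
  simp [mul_comm]

theorem HasGaussianVecCharFun.isCenteredGaussianProcessLaw
    {G : ProbabilityMeasure (T → EuclideanSpace ℝ (Fin m))} {K : T → T → ℝ}
    (h : HasGaussianVecCharFun (G : Measure (T → EuclideanSpace ℝ (Fin m))) K)
    (hK : ∀ x y, K x y = K y x) : IsCenteredGaussianProcessLaw G K := by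
  classical
  -- Evaluations become linear combinations with indicator coefficients, so that the formulas for
  -- sums apply.
  have heval : ∀ (S : Finset T) (x : T) (i : Fin m), x ∈ S →
      (fun z : T → EuclideanSpace ℝ (Fin m) => z x i) = fun z => ∑ x' ∈ S, ∑ i',
        (if x' = x then if i' = i then 1 else 0 else 0) * z x' i' := by
    intro S x i hx
    funext z
    simp [ite_mul, Finset.sum_ite_eq', hx]
  refine ⟨⟨fun I => ⟨isGaussian_of_map_eq_gaussianReal fun L => ?_⟩⟩, fun x i => ?_,
    fun x y i j => ?_⟩
  · let c : T → Fin m → ℝ := fun x i =>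
      if hx : x ∈ I then L (Pi.single ⟨x, hx⟩ (EuclideanSpace.single i 1)) else 0
    refine ⟨0, (∑ i, ∑ x ∈ I, ∑ y ∈ I, c x i * c y i * K x y).toNNReal, ?_⟩
    rw [Measure.map_map (by fun_prop) (by fun_prop), ← (h.map_eq_gaussianReal I c).2]
    congr 1
    funext z
    rw [Function.comp_apply, strongDual_apply_eq_sum, ← Finset.sum_coe_sort I]
    simp [c]
  · rw [heval {x} x i (by simp)]
    exact h.integral_eq_zero _ _
  · rw [heval {x, y} x i (by simp), heval {x, y} y j (by simp), h.covariance_sum_eq hK]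
    by_cases hij : i = j <;> by_cases hxy : x = y <;>
      simp [hij, hxy, ite_mul, mul_ite, Finset.sum_ite_eq', eq_comm (a := j)]

/-- The law of the `ℝᵐ`-valued process whose coordinates are independent with law `P`. -/
noncomputable def iidCoordLaw (m : ℕ) (P : ProbabilityMeasure (T → ℝ)) :
    ProbabilityMeasure (T → EuclideanSpace ℝ (Fin m)) :=
  ⟨(Measure.pi fun _ : Fin m => (P : Measure (T → ℝ))).map fun z x => WithLp.toLp 2 fun i => z i x,
    Measure.isProbabilityMeasure_map (Measurable.aemeasurable (by fun_prop))⟩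

lemma HasGaussianCharFun.iidCoordLaw {P : ProbabilityMeasure (T → ℝ)} {K : T → T → ℝ}
    (h : HasGaussianCharFun (P : Measure (T → ℝ)) K) (m : ℕ) :
    HasGaussianVecCharFun
      (iidCoordLaw m P : Measure (T → EuclideanSpace ℝ (Fin m))) K := by
  intro S c
  rw [_root_.iidCoordLaw, ProbabilityMeasure.coe_mk,
    integral_map (Measurable.aemeasurable (by fun_prop))
      (Measurable.aestronglyMeasurable (by fun_prop))]
  have h1 : ∀ z : Fin m → T → ℝ,
      Complex.exp (((∑ x ∈ S, ∑ i, c x i * z i x : ℝ) : ℂ) * Complex.I) =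
        ∏ i, Complex.exp (((∑ x ∈ S, c x i * z i x : ℝ) : ℂ) * Complex.I) := fun z => by
    rw [← Complex.exp_sum, ← Finset.sum_mul, Finset.sum_comm]
    push_cast
    rfl
  simp_rw [h1]
  rw [integral_fintype_prod_eq_prod (f := fun i (z : T → ℝ) =>
    Complex.exp (((∑ x ∈ S, c x i * z x : ℝ) : ℂ) * Complex.I))]
  simp_rw [h S (fun x => c x _)]
  rw [← Complex.ofReal_prod, ← Real.exp_sum, Finset.sum_neg_distrib, Finset.sum_div]

end VectorValued

/-! ### Weak convergence through characteristic functions. -/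

/-- **Lévy's continuity theorem** for laws on `S → ℝᵐ`. -/
lemma tendsto_of_tendsto_integral_exp {S : Type*} [Fintype S] {m : ℕ}
    {μ : ℕ → ProbabilityMeasure (S → EuclideanSpace ℝ (Fin m))}
    {μ₀ : ProbabilityMeasure (S → EuclideanSpace ℝ (Fin m))}
    (h : ∀ c : S → Fin m → ℝ, Tendsto
      (fun n => ∫ z, Complex.exp (((∑ x, ∑ i, c x i * z x i : ℝ) : ℂ) * Complex.I)
        ∂(μ n : Measure (S → EuclideanSpace ℝ (Fin m)))) atTop
      (𝓝 (∫ z, Complex.exp (((∑ x, ∑ i, c x i * z x i : ℝ) : ℂ) * Complex.I)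
        ∂(μ₀ : Measure (S → EuclideanSpace ℝ (Fin m)))))) :
    Tendsto μ atTop (𝓝 μ₀) := by
  -- `charFun` needs an inner product, whereas the function space carries the sup norm; laws are
  -- moved to the `ℓ²` product and back.
  let toE : (S → EuclideanSpace ℝ (Fin m)) → PiLp 2 fun _ : S => EuclideanSpace ℝ (Fin m) :=
    WithLp.toLp 2
  let ofE : (PiLp 2 fun _ : S => EuclideanSpace ℝ (Fin m)) → S → EuclideanSpace ℝ (Fin m) :=
    WithLp.ofLp
  have hto : Measurable toE := WithLp.measurable_toLp 2 _
  have hof : Continuous ofE := PiLp.continuous_ofLp 2 _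
  have hinv : ∀ ν : ProbabilityMeasure (S → EuclideanSpace ℝ (Fin m)),
      (ν.map hto.aemeasurable).map hof.measurable.aemeasurable = ν := fun ν => by
    apply Subtype.ext
    simp only [ProbabilityMeasure.map, ProbabilityMeasure.coe_mk]
    rw [Measure.map_map hof.measurable hto]
    exact Measure.map_id
  have hchar : ∀ (ν : ProbabilityMeasure (S → EuclideanSpace ℝ (Fin m)))
      (t : PiLp 2 fun _ : S => EuclideanSpace ℝ (Fin m)),
      charFun (ν.map hto.aemeasurable : Measure (PiLp 2 fun _ : S => EuclideanSpace ℝ (Fin m))) t =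
        ∫ z, Complex.exp (((∑ x, ∑ i, t x i * z x i : ℝ) : ℂ) * Complex.I)
          ∂(ν : Measure (S → EuclideanSpace ℝ (Fin m))) := fun ν t => by
    rw [charFun_apply, ProbabilityMeasure.toMeasure_map, integral_map hto.aemeasurable (by fun_prop)]
    simp [toE, PiLp.inner_apply]
  have hlim : Tendsto (fun n => (μ n).map hto.aemeasurable) atTop
      (𝓝 (μ₀.map hto.aemeasurable)) :=
    ProbabilityMeasure.tendsto_of_tendsto_charFun fun t => by
      simp_rw [hchar]
      exact h fun x i => t x i
  have := ((ProbabilityMeasure.continuous_map hof).tendsto _).comp hlim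
  rw [hinv] at this
  exact this.congr fun n => hinv (μ n)

lemma eq_of_integral_exp_eq {S : Type*} [Fintype S] {m : ℕ}
    {μ ν : ProbabilityMeasure (S → EuclideanSpace ℝ (Fin m))}
    (h : ∀ c : S → Fin m → ℝ,
      ∫ z, Complex.exp (((∑ x, ∑ i, c x i * z x i : ℝ) : ℂ) * Complex.I)
          ∂(μ : Measure (S → EuclideanSpace ℝ (Fin m))) =
        ∫ z, Complex.exp (((∑ x, ∑ i, c x i * z x i : ℝ) : ℂ) * Complex.I)
          ∂(ν : Measure (S → EuclideanSpace ℝ (Fin m)))) : μ = ν :=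
  tendsto_nhds_unique (tendsto_const_nhds (x := μ) (f := atTop (α := ℕ)))
    (tendsto_of_tendsto_integral_exp fun c => by rw [h c]; exact tendsto_const_nhds)

/-! ### Trigonometric moments of Gaussian processes. -/

section SinMoments

variable {T : Type*} {P : Measure (T → ℝ)} [IsProbabilityMeasure P] {K : T → T → ℝ}

lemma HasGaussianCharFun.integral_cos (h : HasGaussianCharFun P K) (hK : ∀ x y, K x y = K y x)
    (x y : T) (a b : ℝ) :
    ∫ z, Real.cos (a * z x + b * z y) ∂P =
      Real.exp (-((a ^ 2 * K x x + 2 * a * b * K x y + b ^ 2 * K y y) / 2)) := by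
  classical
  have h1 : ∫ z, Complex.exp (((a * z x + b * z y : ℝ) : ℂ) * Complex.I) ∂P =
      ((Real.exp (-((a ^ 2 * K x x + 2 * a * b * K x y + b ^ 2 * K y y) / 2)) : ℝ) : ℂ) := by
    -- Adding the two indicators gives the right coefficient `a + b` when `x = y`.
    have h2 := h {x, y} fun w => (if w = x then a else 0) + if w = y then b else 0
    by_cases hxy : x = y
    · subst hxy
      simp only [Finset.insert_eq_of_mem, Finset.mem_singleton, Finset.sum_singleton, if_true] at h2
      convert h2 using 4 <;> ring_nf
    · simp only [Finset.sum_pair hxy, if_true, if_neg hxy, if_neg (Ne.symm hxy), add_zero,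
        zero_add] at h2
      rw [h2, hK y x]
      congr 4
      ring
  have h3 := congrArg Complex.re h1
  rw [Complex.ofReal_re] at h3
  rw [← h3]
  have hint := integrable_exp_mul_I (μ := P) (f := fun z : T → ℝ => a * z x + b * z y)
    (Measurable.aestronglyMeasurable (by fun_prop))
  have h4 := integral_re hint
  simp only [RCLike.re_to_complex, Complex.exp_ofReal_mul_I_re] at h4
  exact h4

/-- The covariance of the sines of two centered jointly Gaussian variables. -/
lemma HasGaussianCharFun.integral_sin_mul_sin (h : HasGaussianCharFun P K)
    (hK : ∀ x y, K x y = K y x) (x y : T) :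
    ∫ z, Real.sin (z x) * Real.sin (z y) ∂P =
      1 / 2 * Real.exp (-(1 / 2) * (K x x + K y y)) * (Real.exp (K x y) - Real.exp (-K x y)) := by
  have hint : ∀ b : ℝ, Integrable (fun z : T → ℝ => Real.cos (1 * z x + b * z y)) P := fun b =>
    Integrable.of_bound (C := 1) (Measurable.aestronglyMeasurable (by fun_prop))
      (Eventually.of_forall fun z => Real.abs_cos_le_one _)
  have h1 : ∀ z : T → ℝ, Real.sin (z x) * Real.sin (z y) =
      1 / 2 * (Real.cos (1 * z x + (-1) * z y) - Real.cos (1 * z x + 1 * z y)) := fun z => by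
    rw [one_mul, one_mul, neg_one_mul, ← sub_eq_add_neg, Real.cos_sub, Real.cos_add]
    ring
  simp_rw [h1]
  rw [integral_const_mul, integral_sub (hint _) (hint _), h.integral_cos hK, h.integral_cos hK,
    mul_assoc (1 / 2) (Real.exp _), mul_sub (Real.exp _), ← Real.exp_add, ← Real.exp_add]
  ring_nf

end SinMoments

/-! ### The layer parameters and the large-width limit. -/

lemma ssnKernel_comm (ω : ℝ) (d L : ℕ) (x y : EuclideanSpace ℝ (Fin d)) :
    ssnKernel ω d L x y = ssnKernel ω d L y x := by
  induction L with
  | zero => simp only [ssnKernel, real_inner_comm]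
  | succ L ih => rw [ssnKernel, ssnKernel, ih, add_comm (ssnKernel ω d L x x)]

lemma integral_exp_layerLaw {k m : ℕ} (a : Fin m → Fin k → ℝ) (β : Fin m → ℝ) :
    ∫ θ, Complex.exp (((∑ i, ((∑ j, a i j * θ.1 i j) + β i * θ.2 i) : ℝ) : ℂ) * Complex.I)
        ∂(layerLaw k m) =
      ((Real.exp (-((∑ i, ((∑ j, a i j ^ 2) + β i ^ 2)) / 2)) : ℝ) : ℂ) := by
  have h1 : ∀ θ : LayerParams k m,
      Complex.exp (((∑ i, ((∑ j, a i j * θ.1 i j) + β i * θ.2 i) : ℝ) : ℂ) * Complex.I) =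
      (∏ i, Complex.exp (((∑ j, a i j * θ.1 i j : ℝ) : ℂ) * Complex.I)) *
        Complex.exp (((∑ i, β i * θ.2 i : ℝ) : ℂ) * Complex.I) := fun θ => by
    rw [← Complex.exp_sum, ← Complex.exp_add, ← Finset.sum_mul, ← add_mul,
      Finset.sum_add_distrib]
    push_cast
    rfl
  simp_rw [h1]
  rw [layerLaw, integral_prod_mul
    (f := fun w : Fin m → Fin k → ℝ =>
      ∏ i, Complex.exp (((∑ j, a i j * w i j : ℝ) : ℂ) * Complex.I))
    (g := fun b : Fin m → ℝ => Complex.exp (((∑ i, β i * b i : ℝ) : ℂ) * Complex.I)),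
    integral_fintype_prod_eq_prod (f := fun i (w : Fin k → ℝ) =>
      Complex.exp (((∑ j, a i j * w j : ℝ) : ℂ) * Complex.I))]
  simp_rw [integral_exp_sum_mul_I_pi_gaussianReal]
  rw [← Complex.ofReal_prod, ← Complex.ofReal_mul, ← Real.exp_sum, ← Real.exp_add,
    Finset.sum_neg_distrib, ← Finset.sum_div, Finset.sum_add_distrib]
  congr 2
  ring

/-- Dominated convergence gives `k (E e^(-Y/k) - 1) → -E Y`, with bound `C` because `1 - e^(-u) ≤
u`; then `(1 + g k)^k → e^t` whenever `k g k → t`. -/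
lemma tendsto_integral_exp_neg_div_pow {Ω : Type*} [MeasurableSpace Ω] {P : Measure Ω}
    [IsProbabilityMeasure P] {Y : Ω → ℝ} (hY : Measurable Y) (hY0 : ∀ z, 0 ≤ Y z) {C : ℝ}
    (hYC : ∀ z, Y z ≤ C) :
    Tendsto (fun k : ℕ => (∫ z, Real.exp (-(Y z / k)) ∂P) ^ k) atTop
      (𝓝 (Real.exp (-∫ z, Y z ∂P))) := by
  have hint : ∀ k : ℕ, Integrable (fun z => Real.exp (-(Y z / k))) P := fun k =>
    Integrable.of_bound (C := 1) (Measurable.aestronglyMeasurable (by fun_prop))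
      (Eventually.of_forall fun z => by
        rw [Real.norm_of_nonneg (Real.exp_pos _).le, Real.exp_le_one_iff, neg_nonpos]
        exact div_nonneg (hY0 z) (Nat.cast_nonneg k))
  have hlim : Tendsto (fun k : ℕ => ∫ z, (k : ℝ) * (Real.exp (-(Y z / k)) - 1) ∂P) atTop
      (𝓝 (∫ z, -Y z ∂P)) := by
    refine tendsto_integral_of_dominated_convergence (fun _ => C)
      (fun k => Measurable.aestronglyMeasurable (by fun_prop)) (integrable_const C)
      (fun k => Eventually.of_forall fun z => ?_) (Eventually.of_forall fun z => ?_)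
    · rcases Nat.eq_zero_or_pos k with rfl | hk
      · simpa using (hY0 z).trans (hYC z)
      have hk' : (0 : ℝ) < k := Nat.cast_pos.2 hk
      have h1 := Real.add_one_le_exp (-(Y z / k))
      have h2 : Real.exp (-(Y z / k)) ≤ 1 := by
        rw [Real.exp_le_one_iff, neg_nonpos]
        exact div_nonneg (hY0 z) hk'.le
      rw [norm_mul, Real.norm_of_nonneg hk'.le, Real.norm_of_nonpos (by linarith)]
      calc (k : ℝ) * -(Real.exp (-(Y z / k)) - 1) ≤ k * (Y z / k) := by gcongr; linarith
        _ = Y z := by field_simp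
        _ ≤ C := hYC z
    -- The pointwise limit is the derivative of `t ↦ e^(-Y t)` at 0, sampled along `t = 1/k`.
    · have hd : HasDerivAt (fun t : ℝ => Real.exp (-(Y z * t))) (-Y z) 0 := by
        have := (((hasDerivAt_id (0 : ℝ)).const_mul (Y z)).neg).exp
        simpa using this
      have h1 := hd.tendsto_slope_zero_right.comp
        (tendsto_nhdsWithin_of_tendsto_nhds_of_eventually_within _
          (tendsto_inv_atTop_nhds_zero_nat (𝕜 := ℝ))
          (by filter_upwards [eventually_gt_atTop 0] with k hk
              exact Set.mem_Ioi.2 (inv_pos.2 (Nat.cast_pos.2 hk))))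
      refine h1.congr fun k => ?_
      simp [div_eq_mul_inv]
  rw [integral_neg] at hlim
  refine (Real.tendsto_one_add_pow_exp_of_tendsto
    (g := fun k => ∫ z, Real.exp (-(Y z / k)) ∂P - 1) (hlim.congr fun k => ?_)).congr fun k => ?_
  · rw [integral_const_mul, integral_sub (hint k) (integrable_const _)]
    simp
  · ring

lemma SeqLimit.map {X Y : Type*} [TopologicalSpace X] [TopologicalSpace Y] {φ : X → Y}
    (hφ : Continuous φ) {L : ℕ} {F : (Fin L → ℕ) → X} {a : X} (h : SeqLimit L F a) :
    SeqLimit L (fun n => φ (F n)) (φ a) := by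
  induction L generalizing a with
  | zero => exact congrArg φ h
  | succ L ih =>
    obtain ⟨g, hg, ha⟩ := h
    exact ⟨fun k => φ (g k), fun k hk => ih (hg k hk), (hφ.tendsto a).comp ha⟩

/-! ### One hidden layer as an operation on laws. -/

section HiddenLayer

variable {S : Type*}

/-- One hidden layer, applied to the values of a random function on `S`. -/
noncomputable def hiddenLayer (k m : ℕ)
    (p : (S → EuclideanSpace ℝ (Fin k)) × LayerParams k m) : S → EuclideanSpace ℝ (Fin m) :=
  fun x => affineLayer p.2 (WithLp.toLp 2 fun j => 1 / √(k : ℝ) * Real.sin (p.1 x j))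

lemma continuous_hiddenLayer (k m : ℕ) : Continuous (hiddenLayer (S := S) k m) := by
  unfold hiddenLayer affineLayer
  fun_prop

lemma measurable_hiddenLayer (k m : ℕ) : Measurable (hiddenLayer (S := S) k m) := by
  unfold hiddenLayer affineLayer
  fun_prop

/-- The law of the values after one more layer, whose parameters are independent of the input. -/
noncomputable def hiddenLayerLaw (k m : ℕ)
    (ν : ProbabilityMeasure (S → EuclideanSpace ℝ (Fin k))) :
    ProbabilityMeasure (S → EuclideanSpace ℝ (Fin m)) :=
  (ν.prod ⟨layerLaw k m, inferInstance⟩).map (measurable_hiddenLayer k m).aemeasurable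

lemma continuous_hiddenLayerLaw [Finite S] (k m : ℕ) :
    Continuous (hiddenLayerLaw (S := S) k m) :=
  (ProbabilityMeasure.continuous_map (continuous_hiddenLayer k m)).comp
    (ProbabilityMeasure.continuous_prod.comp (continuous_id.prodMk continuous_const))

/-- Fubini with the parameters integrated first: for fixed `z` the exponent is linear in them, so
`integral_exp_layerLaw` applies. -/
lemma integral_exp_hiddenLayerLaw [Fintype S] (k m : ℕ)
    (ν : ProbabilityMeasure (S → EuclideanSpace ℝ (Fin k))) (c : S → Fin m → ℝ) :
    ∫ w, Complex.exp (((∑ x, ∑ i, c x i * w x i : ℝ) : ℂ) * Complex.I)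
        ∂(hiddenLayerLaw k m ν : Measure (S → EuclideanSpace ℝ (Fin m))) =
      ((∫ z, Real.exp (-((∑ i, ((∑ j, (1 / √(k : ℝ) * ∑ x, c x i * Real.sin (z x j)) ^ 2) +
        (∑ x, c x i) ^ 2)) / 2)) ∂(ν : Measure (S → EuclideanSpace ℝ (Fin k))) : ℝ) : ℂ) := by
  rw [hiddenLayerLaw, ProbabilityMeasure.toMeasure_map,
    integral_map (measurable_hiddenLayer k m).aemeasurable
      (Measurable.aestronglyMeasurable (by fun_prop))]
  change ∫ p, _ ∂((ν : Measure (S → EuclideanSpace ℝ (Fin k))).prod (layerLaw k m)) = _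
  rw [integral_prod _ ?_, ← integral_complex_ofReal]
  · refine integral_congr_ae (Eventually.of_forall fun z => ?_)
    simp only
    rw [← integral_exp_layerLaw]
    refine integral_congr_ae (Eventually.of_forall fun θ => ?_)
    simp only [hiddenLayer, affineLayer]
    congr 3
    rw [Finset.sum_comm]
    refine Finset.sum_congr rfl fun i _ => ?_
    simp only [mul_add, Finset.sum_add_distrib, Finset.mul_sum, Finset.sum_mul]
    rw [Finset.sum_comm]
    congr 1
    exact Finset.sum_congr rfl fun j _ => Finset.sum_congr rfl fun x _ => by ring
  · refine integrable_exp_mul_I (Measurable.aestronglyMeasurable ?_)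
    have := measurable_hiddenLayer (S := S) k m
    fun_prop

end HiddenLayer

/-- A layer acts separately at each input point and its parameters are independent of the earlier
ones, so the law on `S` depends only on the previous law on the same `S`. -/
lemma finDimLaw_sinNetLaw_succ (ω : ℝ) (d L m : ℕ) (n : Fin (L + 1) → ℕ)
    (S : Finset (EuclideanSpace ℝ (Fin d))) :
    finDimLaw (sinNetLaw ω d (L + 1) n m) S =
      hiddenLayerLaw (n (Fin.last L)) m
        (finDimLaw (sinNetLaw ω d L (Fin.init n) (n (Fin.last L))) S) := by
  apply Subtype.ext
  have hm := measurable_sinNet ω d L (Fin.init n) (n (Fin.last L))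
  have hm' := measurable_sinNet ω d (L + 1) n m
  have hS : Measurable (S.restrict (π := fun _ => EuclideanSpace ℝ (Fin (n (Fin.last L))))) :=
    Finset.measurable_restrict S
  have hS' : Measurable (S.restrict (π := fun _ => EuclideanSpace ℝ (Fin m))) :=
    Finset.measurable_restrict S
  change ((paramLaw d (L + 1) n m).map (sinNet ω d (L + 1) n m)).map S.restrict =
    ((((paramLaw d L (Fin.init n) (n (Fin.last L))).map
      (sinNet ω d L (Fin.init n) (n (Fin.last L)))).map S.restrict).prod
        (layerLaw (n (Fin.last L)) m)).map (hiddenLayer _ m)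
  rw [Measure.map_map hS' hm', Measure.map_map hS hm]
  conv_rhs => rw [← Measure.map_id (μ := layerLaw (n (Fin.last L)) m)]
  rw [Measure.map_prod_map _ _ (hS.comp hm) measurable_id,
    Measure.map_map (measurable_hiddenLayer _ m) ((hS.comp hm).prodMap measurable_id)]
  rfl

/-! ### Existence of the limit processes and induction on depth. -/

lemma memLp_sin_eval {T : Type*} (P : ProbabilityMeasure (T → ℝ)) (x : T) :
    MemLp (fun z : T → ℝ => Real.sin (z x)) 2 (P : Measure (T → ℝ)) :=
  MemLp.of_bound (Measurable.aestronglyMeasurable (by fun_prop)) 1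
    (Eventually.of_forall fun z => Real.abs_sin_le_one _)

theorem exists_hasGaussianCharFun_ssnKernel (ω : ℝ) (d L : ℕ) :
    ∃ P : ProbabilityMeasure (EuclideanSpace ℝ (Fin d) → ℝ),
      HasGaussianCharFun (P : Measure (EuclideanSpace ℝ (Fin d) → ℝ)) (ssnKernel ω d L) := by
  induction L with
  | zero =>
    obtain ⟨P, hP⟩ := exists_hasGaussianCharFun (fun x : EuclideanSpace ℝ (Fin d) =>
      (WithLp.toLp 2 (ω • x, ω) : WithLp 2 (EuclideanSpace ℝ (Fin d) × ℝ)))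
    refine ⟨P, ?_⟩
    convert hP using 3 with x y
    simp only [ssnKernel, WithLp.prod_inner_apply, real_inner_smul_left, real_inner_smul_right,
      RCLike.inner_apply, conj_trivial]
    ring
  | succ L ih =>
    obtain ⟨Q, hQ⟩ := ih
    -- The sine component yields `E[sin z_x sin z_y]`; the constant component 1 yields the bias term
    -- `+ 1` of the kernel.
    obtain ⟨P, hP⟩ := exists_hasGaussianCharFun
      (H := WithLp 2 (Lp ℝ 2 (Q : Measure (EuclideanSpace ℝ (Fin d) → ℝ)) × ℝ))
      fun x : EuclideanSpace ℝ (Fin d) => WithLp.toLp 2 ((memLp_sin_eval Q x).toLp _, 1)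
    refine ⟨P, ?_⟩
    convert hP using 3 with x y
    have h1 : inner ℝ ((memLp_sin_eval Q x).toLp _) ((memLp_sin_eval Q y).toLp _) =
        ∫ z, Real.sin (z x) * Real.sin (z y) ∂(Q : Measure (EuclideanSpace ℝ (Fin d) → ℝ)) := by
      rw [L2.inner_def]
      refine integral_congr_ae ?_
      filter_upwards [(memLp_sin_eval Q x).coeFn_toLp, (memLp_sin_eval Q y).coeFn_toLp]
        with z hx hy
      rw [hx, hy]
      simp [mul_comm]
    rw [ssnKernel, WithLp.prod_inner_apply, h1, hQ.integral_sin_mul_sin (ssnKernel_comm ω d L)]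
    simp

/-- The values of a Gaussian process on `S` as a finite-dimensional distribution. -/
lemma HasGaussianVecCharFun.integral_exp_finDimLaw {T : Type*} {m : ℕ}
    {G : ProbabilityMeasure (T → EuclideanSpace ℝ (Fin m))} {K : T → T → ℝ}
    (h : HasGaussianVecCharFun (G : Measure (T → EuclideanSpace ℝ (Fin m))) K) (S : Finset T)
    (c : S → Fin m → ℝ) :
    ∫ w, Complex.exp (((∑ x, ∑ i, c x i * w x i : ℝ) : ℂ) * Complex.I)
        ∂(finDimLaw G S : Measure (S → EuclideanSpace ℝ (Fin m))) =
      ((Real.exp (-((∑ i, ∑ x : S, ∑ y : S, c x i * c y i * K x y) / 2)) : ℝ) : ℂ) := by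
  classical
  rw [finDimLaw, ProbabilityMeasure.toMeasure_map,
    integral_map (Finset.measurable_restrict S).aemeasurable
      (Measurable.aestronglyMeasurable (by fun_prop))]
  have h1 := h S fun x i => if hx : x ∈ S then c ⟨x, hx⟩ i else 0
  simp only [← Finset.sum_coe_sort S] at h1
  simpa using h1

lemma finDimLaw_sinNetLaw_zero (ω : ℝ) (d m : ℕ) (n : Fin 0 → ℕ)
    {P : ProbabilityMeasure (EuclideanSpace ℝ (Fin d) → ℝ)}
    (hP : HasGaussianCharFun (P : Measure (EuclideanSpace ℝ (Fin d) → ℝ)) (ssnKernel ω d 0))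
    (S : Finset (EuclideanSpace ℝ (Fin d))) :
    finDimLaw (sinNetLaw ω d 0 n m) S = finDimLaw (iidCoordLaw m P) S := by
  refine eq_of_integral_exp_eq fun c => ?_
  rw [(hP.iidCoordLaw m).integral_exp_finDimLaw, finDimLaw, ProbabilityMeasure.toMeasure_map,
    integral_map (Finset.measurable_restrict S).aemeasurable
      (Measurable.aestronglyMeasurable (by fun_prop)), sinNetLaw, ProbabilityMeasure.coe_mk,
    integral_map (measurable_sinNet ω d 0 n m).aemeasurable
      (Measurable.aestronglyMeasurable (by fun_prop))]
  change ∫ θ, _ ∂(layerLaw d m) = _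
  have h1 := integral_exp_layerLaw (fun i j => ∑ x : S, ω * c x i * (x : EuclideanSpace ℝ (Fin d)) j)
    (fun i : Fin m => ∑ x : S, ω * c x i)
  have h2 : ∑ i, ∑ x : S, ∑ y : S, c x i * c y i * ssnKernel ω d 0 x y =
      ∑ i, ((∑ j, (∑ x : S, ω * c x i * (x : EuclideanSpace ℝ (Fin d)) j) ^ 2) +
        (∑ x : S, ω * c x i) ^ 2) := by
    refine Finset.sum_congr rfl fun i _ => ?_
    simp only [ssnKernel, PiLp.inner_apply, RCLike.inner_apply, conj_trivial, sq,
      Finset.sum_mul_sum]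
    simp only [mul_add, Finset.mul_sum, Finset.sum_add_distrib]
    congr 1
    · conv_rhs => rw [Finset.sum_comm]
      refine Finset.sum_congr rfl fun x _ => ?_
      conv_rhs => rw [Finset.sum_comm]
      refine Finset.sum_congr rfl fun y _ => Finset.sum_congr rfl fun j _ => ?_
      ring
    · refine Finset.sum_congr rfl fun x _ => Finset.sum_congr rfl fun y _ => ?_
      ring
  rw [h2, ← h1]
  refine integral_congr_ae (Eventually.of_forall fun θ => ?_)
  simp only
  congr 3
  rw [Finset.sum_comm]
  refine Finset.sum_congr rfl fun i _ => ?_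
  change ∑ x : S, c x i * (ω * ((∑ j, θ.1 i j * (x : EuclideanSpace ℝ (Fin d)) j) + θ.2 i)) = _
  simp only [mul_add, Finset.sum_add_distrib, Finset.mul_sum, Finset.sum_mul]
  rw [Finset.sum_comm]
  congr 1
  · exact Finset.sum_congr rfl fun j _ => Finset.sum_congr rfl fun x _ => by ring
  · exact Finset.sum_congr rfl fun x _ => by ring

lemma tendsto_hiddenLayerLaw (ω : ℝ) (d L m : ℕ)
    {P Q : ProbabilityMeasure (EuclideanSpace ℝ (Fin d) → ℝ)}
    (hP : HasGaussianCharFun (P : Measure (EuclideanSpace ℝ (Fin d) → ℝ)) (ssnKernel ω d L))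
    (hQ : HasGaussianCharFun (Q : Measure (EuclideanSpace ℝ (Fin d) → ℝ))
      (ssnKernel ω d (L + 1)))
    (S : Finset (EuclideanSpace ℝ (Fin d))) :
    Tendsto (fun k => hiddenLayerLaw k m (finDimLaw (iidCoordLaw k P) S)) atTop
      (𝓝 (finDimLaw (iidCoordLaw m Q) S)) := by
  refine tendsto_of_tendsto_integral_exp fun c => ?_
  rw [(hQ.iidCoordLaw m).integral_exp_finDimLaw]
  simp_rw [integral_exp_hiddenLayerLaw]
  refine (Complex.continuous_ofReal.tendsto _).comp ?_
  -- `Y / k` is the contribution of one hidden neuron to the exponent; `β / 2` is that of the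
  -- biases.
  let Y : (EuclideanSpace ℝ (Fin d) → ℝ) → ℝ := fun z =>
    (∑ i, (∑ x : S, c x i * Real.sin (z x)) ^ 2) / 2
  let β : ℝ := ∑ i, (∑ x : S, c x i) ^ 2
  have hY : Measurable Y := by fun_prop
  have hY0 : ∀ z, 0 ≤ Y z := fun z => by positivity
  have hYC : ∀ z, Y z ≤ (∑ i, (∑ x : S, |c x i|) ^ 2) / 2 := fun z => by
    refine div_le_div_of_nonneg_right (Finset.sum_le_sum fun i _ => ?_) (by norm_num)
    rw [← sq_abs]
    gcongr
    refine (Finset.abs_sum_le_sum_abs _ _).trans (Finset.sum_le_sum fun x _ => ?_)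
    rw [abs_mul]
    exact mul_le_of_le_one_right (abs_nonneg _) (Real.abs_sin_le_one _)
  have hsin : ∀ x y : S, Integrable
      (fun z => Real.sin (z x) * Real.sin (z y)) (P : Measure (EuclideanSpace ℝ (Fin d) → ℝ)) :=
    fun x y => (memLp_sin_eval P x).integrable_mul (memLp_sin_eval P y)
  -- The `- 1` removes the bias part of the kernel, which `β` restores in `htarget`.
  have hYint : ∫ z, Y z ∂(P : Measure (EuclideanSpace ℝ (Fin d) → ℝ)) =
      (∑ i, ∑ x : S, ∑ y : S, c x i * c y i * (ssnKernel ω d (L + 1) x y - 1)) / 2 := by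
    have h1 : ∀ z, Y z = (∑ i, ∑ x : S, ∑ y : S,
        c x i * c y i * (Real.sin (z x) * Real.sin (z y))) / 2 := fun z => by
      simp only [Y, sq, Finset.sum_mul_sum]
      simp only [mul_mul_mul_comm]
    simp_rw [h1]
    rw [integral_div, integral_finsetSum _ fun i _ => integrable_finsetSum _ fun x _ =>
      integrable_finsetSum _ fun y _ => (hsin x y).const_mul _]
    congr 1
    refine Finset.sum_congr rfl fun i _ => ?_
    rw [integral_finsetSum _ fun x _ => integrable_finsetSum _ fun y _ => (hsin x y).const_mul _]
    refine Finset.sum_congr rfl fun x _ => ?_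
    rw [integral_finsetSum _ fun y _ => (hsin x y).const_mul _]
    refine Finset.sum_congr rfl fun y _ => ?_
    rw [integral_const_mul, hP.integral_sin_mul_sin (ssnKernel_comm ω d L), ssnKernel,
      add_sub_cancel_right]
  have hlim := (tendsto_integral_exp_neg_div_pow
    (P := (P : Measure (EuclideanSpace ℝ (Fin d) → ℝ))) hY hY0 hYC).const_mul (Real.exp (-(β / 2)))
  have htarget : Real.exp (-(β / 2)) *
      Real.exp (-∫ z, Y z ∂(P : Measure (EuclideanSpace ℝ (Fin d) → ℝ))) =
      Real.exp (-((∑ i, ∑ x : S, ∑ y : S, c x i * c y i * ssnKernel ω d (L + 1) x y) / 2)) := by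
    rw [← Real.exp_add, hYint]
    congr 1
    simp only [β, sq, Finset.sum_mul_sum, mul_sub, Finset.sum_sub_distrib, mul_one]
    ring
  rw [htarget] at hlim
  refine hlim.congr fun k => ?_
  rw [finDimLaw, ProbabilityMeasure.toMeasure_map,
    integral_map (Finset.measurable_restrict S).aemeasurable
      (Measurable.aestronglyMeasurable (by fun_prop)), iidCoordLaw, ProbabilityMeasure.coe_mk,
    integral_map (Measurable.aemeasurable (by fun_prop))
      (Measurable.aestronglyMeasurable (by fun_prop))]
  have h1 : ∀ z : Fin k → EuclideanSpace ℝ (Fin d) → ℝ,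
      Real.exp (-((∑ i, ((∑ j, (1 / √(k : ℝ) * ∑ x : S, c x i * Real.sin (z j x)) ^ 2) +
        (∑ x : S, c x i) ^ 2)) / 2)) =
      Real.exp (-(β / 2)) * ∏ j, Real.exp (-(Y (z j) / k)) := fun z => by
    rw [← Real.exp_sum, ← Real.exp_add]
    congr 1
    simp only [mul_pow, div_pow, Real.sq_sqrt (Nat.cast_nonneg k), one_pow,
      Finset.sum_add_distrib, Y, β, Finset.sum_neg_distrib]
    rw [Finset.sum_comm]
    simp only [← Finset.mul_sum, ← Finset.sum_div]
    ring
  have h2 := integral_fintype_prod_eq_pow (ι := Fin k)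
    (μ := (P : Measure (EuclideanSpace ℝ (Fin d) → ℝ))) (fun z => Real.exp (-(Y z / k)))
  rw [Fintype.card_fin] at h2
  rw [← h2, ← integral_const_mul]
  exact integral_congr_ae (Eventually.of_forall fun z => (h1 z).symm)

theorem seqLimit_finDimLaw_sinNetLaw (ω : ℝ) (d L m : ℕ)
    {P : ProbabilityMeasure (EuclideanSpace ℝ (Fin d) → ℝ)}
    (hP : HasGaussianCharFun (P : Measure (EuclideanSpace ℝ (Fin d) → ℝ)) (ssnKernel ω d L))
    (S : Finset (EuclideanSpace ℝ (Fin d))) :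
    SeqLimit L (fun n : Fin L → ℕ => finDimLaw (sinNetLaw ω d L n m) S)
      (finDimLaw (iidCoordLaw m P) S) := by
  -- The output dimension must vary: the last hidden width `k` is the output dimension of the
  -- shallower network.
  induction L generalizing m P with
  | zero => exact finDimLaw_sinNetLaw_zero ω d m _ hP S
  | succ L ih =>
    obtain ⟨Q, hQ⟩ := exists_hasGaussianCharFun_ssnKernel ω d L
    refine ⟨fun k => hiddenLayerLaw k m (finDimLaw (iidCoordLaw k Q) S), fun k _ => ?_,
      tendsto_hiddenLayerLaw ω d L m hQ hP S⟩
    have h := (ih k hQ).map (continuous_hiddenLayerLaw (S := S) k m)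
    have h1 : ∀ n : Fin L → ℕ, finDimLaw (sinNetLaw ω d (L + 1) (Fin.snoc n k) m) S =
        hiddenLayerLaw k m (finDimLaw (sinNetLaw ω d L n k) S) := fun n => by
      have h2 := finDimLaw_sinNetLaw_succ ω d L m (Fin.snoc n k) S
      rwa [Fin.init_snoc, Fin.snoc_last] at h2
    simp_rw [h1]
    exact h

theorem mainTheorem3 (ω : ℝ) (d L m : ℕ) :
    ∃ G : ProbabilityMeasure (EuclideanSpace ℝ (Fin d) → EuclideanSpace ℝ (Fin m)),
      IsCenteredGaussianProcessLaw G (ssnKernel ω d L) ∧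
      ∀ S : Finset (EuclideanSpace ℝ (Fin d)),
        SeqLimit L (fun n : Fin L → ℕ => finDimLaw (sinNetLaw ω d L n m) S) (finDimLaw G S) := by
  obtain ⟨P, hP⟩ := exists_hasGaussianCharFun_ssnKernel ω d L
  exact ⟨iidCoordLaw m P,
    (hP.iidCoordLaw m).isCenteredGaussianProcessLaw (ssnKernel_comm ω d L),
    fun S => seqLimit_finDimLaw_sinNetLaw ω d L m hP S⟩
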